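/- Definitions. Let $\mathcal C$ be an additive category with a biadditive functor $\mathbb E:\mathcal C^{op}\times\mathcal C\to Ab$, and write $a_*\delta=\mathbb E(C,a)(\delta)$, $c^*\delta=\mathbb E(c,A)(\delta)$. Two sequences $A\to B\to C$ and $A\to B'\to C$ are equivalent if there is an isomorphism $B\cong B'$ compatible with the maps from $A$ and to $C$. Let $\mathfrak s$ assign to each $\delta\in\mathbb E(C,A)$ an equivalence class $\mathfrak s(\delta)=[A\xrightarrow{x}B\xrightarrow{y}C]$; then $(A\xrightarrow{x}B\xrightarrow{y}C,\delta)$ is called an $\mathfrak s$-triangle, $x$ an inflation and $y$ a deflation. The triplet $(\mathcal C,\mathbb E,\mathfrak s)$ is a weakly extriangulated category if (C1) for every $\mathfrak s$-triangle as above and every object $X$, the sequences $\mathcal C(X,A)\to\mathcal C(X,B)\to\mathcal C(X,C)\to\mathbb E(X,A)$ and $\mathcal C(C,X)\to\mathcal C(B,X)\to\mathcal C(A,X)\to\mathbb E(C,X)$, with last maps $f\mapsto f^*\delta$ and $g\mapsto g_*\delta$, are exact; (C2) $\mathfrak s(0)=[A\xrightarrow{1}A\to0]$ for $0\in\mathbb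 E(0,A)$ and $\mathfrak s(0)=[0\to A\xrightarrow{1}A]$ for $0\in\mathbb E(A,0)$; (C3) for $\mathfrak s$-triangles $(A\xrightarrow{x}B\xrightarrow{y}C,\delta)$ and $(A'\xrightarrow{x'}B'\xrightarrow{y'}C,a_*\delta)$ with $a:A\to A'$ there is $b:B\to B'$ with $bx=x'a$, $y'b=y$ such that $(A\xrightarrow{\binom{x}{a}}B\oplus A'\xrightarrow{(b\ -x')}B',\,y'^*\delta)$ is an $\mathfrak s$-triangle; and, dually, for $\mathfrak s$-triangles $(A\xrightarrow{x}B\xrightarrow{y}C,\delta)$ and $(A\xrightarrow{x'}B'\xrightarrow{y'}C',c^*\delta)$ with $c:C'\to C$ there is $b:B'\to B$ with $bx'=x$, $yb=cy'$ such that $(B'\xrightarrow{\binom{-y'}{b}}C'\oplus B\xrightarrow{(c\ y)}C,\,x'_*\delta)$ is an $\mathfrak s$-triangle. It is extriangulated if moreover inflations and deflations are closed under composition. An exact functor $(F,\phi):(\mathcal C,\mathbb E,\mathfrak s)\to(\mathcal D,\mathbb F,\mathfrak t)$ is an additive functor $F$ with a natural transformation $\phi:\mathbb E\Rightarrow\mathbb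 F\circ(F^{op}\times F)$ such that $\mathfrak t(\phi(\delta))=[FA\xrightarrow{Fx}FB\xrightarrow{Fy}FC]$ for every $\mathfrak s$-triangle. Such pairs compose by $(G,\psi)\circ(F,\phi)=(GF,(\psi\circ(F^{op}\times F))\cdot\phi)$. For a class $\mathscr S$ of morphisms of a small $\mathcal C$, let $Q:\mathcal C\to\widetilde{\mathcal C}$ be the (strictly universal) localization by $\mathscr S$, which has the objects of $\mathcal C$. Let $\widetilde{\mathbb E}:\widetilde{\mathcal C}^{op}\times\widetilde{\mathcal C}\to Ab$, with $\mu:\mathbb E\Rightarrow\widetilde{\mathbb E}\circ(Q^{op}\times Q)$, be the left Kan extension of $\mathbb E$ along $Q^{op}\times Q$. For $t:Z\to C$, $s:A\to X$ in $\mathscr S$ and $\delta\in\mathbb E(Z,X)$ put $[t\backslash\delta/s]=(Q(t)^{-1})^*(Q(s)^{-1})_*\mu(\delta)\in\widetilde{\mathbb E}(C,A)$, and, if $\mathfrak s(\delta)=[X\xrightarrow{x}Y\xrightarrow{y}Z]$, let $\widetilde{\mathfrak s}([t\backslash\delta/s])=[A\xrightarrow{Q(xs)}Y\xrightarrow{Q(ty)}C]$.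 Corollary 3.7. Let $(\mathcal C,\mathbb E,\mathfrak s)$ be an extriangulated category with $\mathcal C$ small, let $(F,\phi):(\mathcal C,\mathbb E,\mathfrak s)\to(\mathcal D,\mathbb F,\mathfrak t)$ be an exact functor to a weakly extriangulated category, and put $\mathscr S=F^{-1}(\mathrm{Iso}(\mathcal D))$. Suppose that $F$ has a fully faithful left adjoint and a fully faithful right adjoint. Then: (1) $\mathscr S$ is a multiplicative system (admits left and right calculus of fractions), so that $\widetilde{\mathcal C}$ is preadditive. Every element of $\widetilde{\mathbb E}(C,A)$ is of the form $[t\backslash\delta/s]$, and $[t_1\backslash\delta_1/s_1]=[t_2\backslash\delta_2/s_2]$ if and only if there are $v_1,v_2,u_1,u_2\in\mathscr S$ with $t_1v_1=t_2v_2$, $u_1s_1=u_2s_2$ and $v_1^*u_{1*}\delta_1=v_2^*u_{2*}\delta_2$. The map $\widetilde{\mathfrak s}$ is well defined, $(\widetilde{\mathcal C},\widetilde{\mathbb E},\widetilde{\mathfrak s})$ is a weakly extriangulated category, and $(Q,\mu)$ is an exact functor to it. (2) There is a unique exact functor $(\widetilde F,\widetilde\phi):(\widetilde{\mathcal C},\widetilde{\mathbb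 E},\widetilde{\mathfrak s})\to(\mathcal D,\mathbb F,\mathfrak t)$ with $(F,\phi)=(\widetilde F,\widetilde\phi)\circ(Q,\mu)$, and $\widetilde F$ is an equivalence of categories. -/

import Mathlib

open CategoryTheory CategoryTheory.Limits Opposite

universe w w₁ w₂ w₃ v v₁ v₂ v₃ u u₁ u₂ u₃

/-- A category `C` equipped with a functor `E : Cᵒᵖ × C ⥤ Ab` and, for each extension
`δ ∈ E(C, A)`, a collection of sequences `A ⟶ B ⟶ C`, which is meant to be an equivalence
class `𝔰(δ)`: `IsTriangle δ x y` says that `𝔰(δ) = [A --x--> B --y--> C]`. That `E` is biadditive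
and that `𝔰(δ)` is precisely one equivalence class is part of
`ExtData.IsWeaklyExtriangulated`. -/
structure ExtData (C : Type u) [Category.{v} C] where
  /-- the functor `E` -/
  E : Cᵒᵖ × C ⥤ AddCommGrpCat.{w}
  /-- `⟨A --x--> B --y--> C, δ⟩` is an `𝔰`-triangle -/
  IsTriangle : ∀ {A B C : C}, E.obj (op C, A) → (A ⟶ B) → (B ⟶ C) → Prop

namespace ExtData

section

variable {C : Type u} [Category.{v} C] (X : ExtData.{w} C)

/-- The group `E(C, A)` of extensions. -/
abbrev Ext (Z A : C) : Type w := X.E.obj (op Z, A)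

/-- `c^* a_* δ = E(c, a)(δ)`. -/
def act {Z Z' A A' : C} (c : Z' ⟶ Z) (a : A ⟶ A') : X.Ext Z A →+ X.Ext Z' A' :=
  (X.E.map (Prod.mkHom c.op a)).hom

/-- `a_* δ`. -/
def push {Z A A' : C} (a : A ⟶ A') : X.Ext Z A →+ X.Ext Z A' := X.act (𝟙 Z) a

/-- `c^* δ`. -/
def pull {Z Z' A : C} (c : Z' ⟶ Z) : X.Ext Z A →+ X.Ext Z' A := X.act c (𝟙 A)

/-- `x` is an `𝔰`-inflation. -/
def IsInflation {A B : C} (x : A ⟶ B) : Prop :=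
  ∃ (Z : C) (y : B ⟶ Z) (δ : X.Ext Z A), X.IsTriangle δ x y

/-- `y` is an `𝔰`-deflation. -/
def IsDeflation {B Z : C} (y : B ⟶ Z) : Prop :=
  ∃ (A : C) (x : A ⟶ B) (δ : X.Ext Z A), X.IsTriangle δ x y

/-- `(C, E, 𝔰)` is a weakly extriangulated category. -/
structure IsWeaklyExtriangulated [Preadditive C] : Prop where
  /-- `C` is an additive category. -/
  hasZeroObject : HasZeroObject C
  hasBinaryBiproducts : HasBinaryBiproducts C
  /-- `E` is biadditive. -/
  add_push : ∀ {Z A A' : C} (a a' : A ⟶ A') (δ : X.Ext Z A),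
    X.push (a + a') δ = X.push a δ + X.push a' δ
  add_pull : ∀ {Z Z' A : C} (c c' : Z' ⟶ Z) (δ : X.Ext Z A),
    X.pull (c + c') δ = X.pull c δ + X.pull c' δ
  /-- `𝔰(δ)` is an equivalence class of sequences. -/
  exists_triangle : ∀ {Z A : C} (δ : X.Ext Z A),
    ∃ (B : C) (x : A ⟶ B) (y : B ⟶ Z), X.IsTriangle δ x y
  triangle_iff : ∀ {Z A B B' : C} {δ : X.Ext Z A} {x : A ⟶ B} {y : B ⟶ Z},
    X.IsTriangle δ x y → ∀ (x' : A ⟶ B') (y' : B' ⟶ Z),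
      (X.IsTriangle δ x' y' ↔ ∃ b : B ≅ B', x ≫ b.hom = x' ∧ b.hom ≫ y' = y)
  /-- For an `𝔰`-triangle, `C(W, A) ⟶ C(W, B) ⟶ C(W, Z) ⟶ E(W, A)` is exact. -/
  exact_mid : ∀ {Z A B : C} {δ : X.Ext Z A} {x : A ⟶ B} {y : B ⟶ Z}, X.IsTriangle δ x y →
    ∀ {W : C} (f : W ⟶ B), f ≫ y = 0 ↔ ∃ g : W ⟶ A, g ≫ x = f
  exact_right : ∀ {Z A B : C} {δ : X.Ext Z A} {x : A ⟶ B} {y : B ⟶ Z}, X.IsTriangle δ x y →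
    ∀ {W : C} (f : W ⟶ Z), X.pull f δ = 0 ↔ ∃ g : W ⟶ B, g ≫ y = f
  /-- Dually, `C(Z, W) ⟶ C(B, W) ⟶ C(A, W) ⟶ E(Z, W)` is exact. -/
  coexact_mid : ∀ {Z A B : C} {δ : X.Ext Z A} {x : A ⟶ B} {y : B ⟶ Z}, X.IsTriangle δ x y →
    ∀ {W : C} (f : B ⟶ W), x ≫ f = 0 ↔ ∃ g : Z ⟶ W, y ≫ g = f
  coexact_right : ∀ {Z A B : C} {δ : X.Ext Z A} {x : A ⟶ B} {y : B ⟶ Z}, X.IsTriangle δ x y →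
    ∀ {W : C} (f : A ⟶ W), X.push f δ = 0 ↔ ∃ g : B ⟶ W, x ≫ g = f
  /-- `𝔰(0) = [A = A ⟶ 0]` for `0 ∈ E(0, A)`. -/
  triangle_id_zero : ∀ (A O : C), IsZero O →
    X.IsTriangle (0 : X.Ext O A) (𝟙 A) (0 : A ⟶ O)
  /-- `𝔰(0) = [0 ⟶ A = A]` for `0 ∈ E(A, 0)`. -/
  triangle_zero_id : ∀ (A O : C), IsZero O →
    X.IsTriangle (0 : X.Ext A O) (0 : O ⟶ A) (𝟙 A)
  /-- `(a, b, 1)` is a morphism of `𝔰`-triangles whose mapping cone is an `𝔰`-triangle. -/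
  good_lift_push : ∀ {Z A A' B B' : C} {δ : X.Ext Z A} {x : A ⟶ B} {y : B ⟶ Z} (a : A ⟶ A')
    {x' : A' ⟶ B'} {y' : B' ⟶ Z}, X.IsTriangle δ x y → X.IsTriangle (X.push a δ) x' y' →
    ∃ b : B ⟶ B', x ≫ b = a ≫ x' ∧ b ≫ y' = y ∧
      X.IsTriangle (X.pull y' δ) (biprod.lift x a) (biprod.desc b (-x'))
  /-- `(1, b, c)` is a morphism of `𝔰`-triangles whose mapping cocone is an `𝔰`-triangle. -/
  good_lift_pull : ∀ {Z Z' A B B' : C} {δ : X.Ext Z A} {x : A ⟶ B} {y : B ⟶ Z} (c : Z' ⟶ Z)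
    {x' : A ⟶ B'} {y' : B' ⟶ Z'}, X.IsTriangle δ x y → X.IsTriangle (X.pull c δ) x' y' →
    ∃ b : B' ⟶ B, x' ≫ b = x ∧ b ≫ y = y' ≫ c ∧
      X.IsTriangle (X.push x' δ) (biprod.lift (-y') b) (biprod.desc c y)

/-- `(C, E, 𝔰)` is an extriangulated category. -/
structure IsExtriangulated [Preadditive C] : Prop extends X.IsWeaklyExtriangulated where
  /-- `𝔰`-inflations are closed under composition. -/
  inflation_comp : ∀ {A A' A'' : C} (f : A ⟶ A') (g : A' ⟶ A''),
    X.IsInflation f → X.IsInflation g → X.IsInflation (f ≫ g)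
  /-- `𝔰`-deflations are closed under composition. -/
  deflation_comp : ∀ {A A' A'' : C} (f : A ⟶ A') (g : A' ⟶ A''),
    X.IsDeflation f → X.IsDeflation g → X.IsDeflation (f ≫ g)

end

end ExtData

/-- A pair `(F, φ)` of a functor `F` and a natural transformation `φ : E ⟹ E' ∘ (Fᵒᵖ × F)` of
functors to abelian groups. -/
structure ExtFunctor {C : Type u₁} [Category.{v₁} C] {D : Type u₂} [Category.{v₂} D]
    (X : ExtData.{w₁} C) (Y : ExtData.{w₂} D) where
  /-- the functor `F` -/
  functor : C ⥤ D
  /-- the homomorphisms `φ_{Z, A} : E(Z, A) → E'(F Z, F A)` -/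
  φ : ∀ Z A : C, X.Ext Z A →+ Y.Ext (functor.obj Z) (functor.obj A)
  naturality : ∀ {Z Z' A A' : C} (c : Z' ⟶ Z) (a : A ⟶ A') (δ : X.Ext Z A),
    φ Z' A' (X.act c a δ) = Y.act (functor.map c) (functor.map a) (φ Z A δ)

namespace ExtFunctor

variable {C : Type u₁} [Category.{v₁} C] {D : Type u₂} [Category.{v₂} D]
  {D' : Type u₃} [Category.{v₃} D']
  {X : ExtData.{w₁} C} {Y : ExtData.{w₂} D} {Z : ExtData.{w₃} D'}

/-- The pair `(F, φ)` is an exact functor. -/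
structure IsExact [Preadditive C] [Preadditive D] (F : ExtFunctor X Y) : Prop where
  additive : F.functor.Additive
  map_triangle : ∀ {A B Z : C} {δ : X.Ext Z A} {x : A ⟶ B} {y : B ⟶ Z}, X.IsTriangle δ x y →
    Y.IsTriangle (F.φ Z A δ) (F.functor.map x) (F.functor.map y)

/-- The composition `(G, ψ) ∘ (F, φ)`, written in diagrammatic order. -/
def comp (F : ExtFunctor X Y) (G : ExtFunctor Y Z) : ExtFunctor X Z where
  functor := F.functor ⋙ G.functor
  φ V A := (G.φ (F.functor.obj V) (F.functor.obj A)).comp (F.φ V A)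
  naturality c a δ := by
    simp [F.naturality, G.naturality]

end ExtFunctor

namespace ExtData

noncomputable section

variable {C : Type u} [SmallCategory C] (X : ExtData.{u} C) (S : MorphismProperty C)

/-- The functor `Ẽ : C̃ᵒᵖ × C̃ ⥤ Ab` on the localization `C̃` of `C` by `S`: the left Kan
extension (equivalently, the coend `C̃ ⊗ E ⊗ C̃`) of `E` along `Qᵒᵖ × Q`. That its elements are the
fractions `[t \ δ / s]` is expressed by `ExtData.IsGivenByFractions` below. -/
def locE : S.Localizationᵒᵖ × S.Localization ⥤ AddCommGrpCat.{u} :=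
  (S.Q.op.prod S.Q).leftKanExtension X.E

/-- The natural homomorphism `μ : E(Z, A) → Ẽ(Q Z, Q A)`. -/
def locμ (Z A : C) : X.Ext Z A →+ (X.locE S).obj (op (S.Q.obj Z), S.Q.obj A) :=
  (((S.Q.op.prod S.Q).leftKanExtensionUnit X.E).app (op Z, A)).hom

variable {S}

/-- The isomorphism `Q(s)` for `s ∈ S`. -/
def locIso {A B : C} (s : A ⟶ B) (hs : S s) : S.Q.obj A ≅ S.Q.obj B :=
  @asIso _ _ _ _ (S.Q.map s) (S.Q_inverts s hs)

/-- The fraction `[t \ δ / s] = (Q(t)⁻¹)^* (Q(s)⁻¹)_* μ(δ) ∈ Ẽ(Q C, Q A)` attached to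
`t : Z ⟶ C` and `s : A ⟶ V` in `S`, and to `δ ∈ E(Z, V)`. -/
def frac {A V Z K : C} (t : Z ⟶ K) (ht : S t) (δ : X.Ext Z V) (s : A ⟶ V) (hs : S s) :
    (X.locE S).obj (op (S.Q.obj K), S.Q.obj A) :=
  ((X.locE S).map (Prod.mkHom (locIso t ht).inv.op (locIso s hs).inv)).hom (X.locμ S Z V δ)

variable (S)

/-- The realization `𝔰̃` on `C̃`: whenever `𝔰(δ) = [V --x--> Y --y--> Z]`, the fraction
`[t \ δ / s]` is realized by the sequences equivalent to `Q A --Q(x ∘ s)--> Q Y --Q(t ∘ y)--> Q K`.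
All objects of `C̃` are of the form `Q A`. -/
inductive LocTriangle : ∀ {A B K : S.Localization},
    (X.locE S).obj (op K, A) → (A ⟶ B) → (B ⟶ K) → Prop
  | mk {A V Y Z K : C} (t : Z ⟶ K) (ht : S t) (s : A ⟶ V) (hs : S s)
      (δ : X.Ext Z V) (x : V ⟶ Y) (y : Y ⟶ Z) (h : X.IsTriangle δ x y)
      {B : S.Localization} (b : S.Q.obj Y ≅ B) :
      LocTriangle (X.frac t ht δ s hs) (S.Q.map (s ≫ x) ≫ b.hom) (b.inv ≫ S.Q.map (y ≫ t))

/-- The triplet `(C̃, Ẽ, 𝔰̃)`. -/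
def localization : ExtData.{u} S.Localization where
  E := X.locE S
  IsTriangle := X.LocTriangle S

/-- The pair `(Q, μ) : (C, E, 𝔰) → (C̃, Ẽ, 𝔰̃)`. -/
def locQ : ExtFunctor X (X.localization S) where
  functor := S.Q
  φ := X.locμ S
  naturality c a δ :=
    ConcreteCategory.congr_hom
      (((S.Q.op.prod S.Q).leftKanExtensionUnit X.E).naturality (Prod.mkHom c.op a)) δ

/-- `Ẽ` is given by fractions: every element of `Ẽ(Q K, Q A)` is a fraction `[t \ δ / s]`, and two
fractions are equal if and only if they have common denominators for which the resulting numerators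
coincide. -/
structure IsGivenByFractions : Prop where
  exists_frac : ∀ {A K : C} (ε : (X.localization S).Ext (S.Q.obj K) (S.Q.obj A)),
    ∃ (Z V : C) (t : Z ⟶ K) (ht : S t) (δ : X.Ext Z V) (s : A ⟶ V) (hs : S s),
      ε = X.frac t ht δ s hs
  frac_eq_iff : ∀ {A K Z₁ Z₂ V₁ V₂ : C} (t₁ : Z₁ ⟶ K) (ht₁ : S t₁) (δ₁ : X.Ext Z₁ V₁)
    (s₁ : A ⟶ V₁) (hs₁ : S s₁) (t₂ : Z₂ ⟶ K) (ht₂ : S t₂) (δ₂ : X.Ext Z₂ V₂)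
    (s₂ : A ⟶ V₂) (hs₂ : S s₂),
    X.frac t₁ ht₁ δ₁ s₁ hs₁ = X.frac t₂ ht₂ δ₂ s₂ hs₂ ↔
      ∃ (Z V : C) (v₁ : Z ⟶ Z₁) (v₂ : Z ⟶ Z₂) (u₁ : V₁ ⟶ V) (u₂ : V₂ ⟶ V),
        S v₁ ∧ S v₂ ∧ S u₁ ∧ S u₂ ∧ v₁ ≫ t₁ = v₂ ≫ t₂ ∧ s₁ ≫ u₁ = s₂ ≫ u₂ ∧
          X.act v₁ u₁ δ₁ = X.act v₂ u₂ δ₂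

end

end ExtData

/-! Since `F` has fully faithful adjoints, it is a localization at the morphisms it inverts. Hence
`Q` followed by the induced equivalence is `F`, and `Q` itself acquires fully faithful adjoints `LL
⊣ Q ⊣ RR`. Then `Qᵒᵖ × Q` is left adjoint to `LLᵒᵖ × RR`, and left Kan extension along a left
adjoint is precomposition with its right adjoint. So `Ẽ(K, A)` is `E(LL K, RR A)`: each extension in
the localization has a canonical numerator in `C`, whose denominators are the counit of `LL ⊣ Q` and
the unit of `Q ⊣ RR` (`act_unitExt_numerator`, `frac_numerator`).

This replaces calculations with fractions. Equality of fractions is equality of numerators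
(`isGivenByFractions`), biadditivity and the mapping cone axioms come from `C` applied to
numerators, and maps out of `Ẽ` are determined by their values on `μ` (`extFunctor_ext`,
`exists_extFunctor`).

The target `D` serves to compare realizations. If `v` and `u` are inverted by `F`, the middle terms
realizing `δ` and `E(v, u)(δ)` are joined by morphisms that become isomorphisms in `D` (`isIso_mid`,
`exists_roof`). As the localization embeds fully faithfully in `D`, they are already isomorphisms
there, so the realization does not depend on the fraction (`exists_iso_numerator`). The same
embedding pulls back from `D` exactness at the middle terms and the lifting half of exactness at the
outer terms. -/

namespace ExtData

/-! ### Functoriality of the action on extensions. -/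

section Act

variable {C : Type u} [Category.{v} C] (X : ExtData.{w} C)

@[simp]
lemma act_act {Z Z' Z'' A A' A'' : C} (c : Z' ⟶ Z) (c' : Z'' ⟶ Z') (a : A ⟶ A') (a' : A' ⟶ A'')
    (δ : X.Ext Z A) : X.act c' a' (X.act c a δ) = X.act (c' ≫ c) (a ≫ a') δ := by
  have h := ConcreteCategory.congr_hom
    (X.E.map_comp (Prod.mkHom c.op a) (Prod.mkHom c'.op a')) δ
  exact h.symm

@[simp]
lemma act_id {Z A : C} (δ : X.Ext Z A) : X.act (𝟙 Z) (𝟙 A) δ = δ :=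
  ConcreteCategory.congr_hom (X.E.map_id (op Z, A)) δ

lemma act_eq_push_pull {Z Z' A A' : C} (c : Z' ⟶ Z) (a : A ⟶ A') (δ : X.Ext Z A) :
    X.act c a δ = X.push a (X.pull c δ) := by
  simp [push, pull]

lemma act_eq_pull_push {Z Z' A A' : C} (c : Z' ⟶ Z) (a : A ⟶ A') (δ : X.Ext Z A) :
    X.act c a δ = X.pull c (X.push a δ) := by
  simp [push, pull]

lemma pull_pull {Z Z' Z'' A : C} (c : Z' ⟶ Z) (c' : Z'' ⟶ Z') (δ : X.Ext Z A) :
    X.pull c' (X.pull c δ) = X.pull (c' ≫ c) δ := by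
  simp [pull]

lemma push_push {Z A A' A'' : C} (a : A ⟶ A') (a' : A' ⟶ A'') (δ : X.Ext Z A) :
    X.push a' (X.push a δ) = X.push (a ≫ a') δ := by
  simp [push]

lemma push_pull_comm {Z Z' A A' : C} (c : Z' ⟶ Z) (a : A ⟶ A') (δ : X.Ext Z A) :
    X.push a (X.pull c δ) = X.pull c (X.push a δ) := by
  rw [← act_eq_push_pull, act_eq_pull_push]

@[simp]
lemma pull_id {Z A : C} (δ : X.Ext Z A) : X.pull (𝟙 Z) δ = δ := X.act_id δ

@[simp]
lemma push_id {Z A : C} (δ : X.Ext Z A) : X.push (𝟙 A) δ = δ := X.act_id δ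

end Act

/-! ### Morphisms of triangles with invertible outer components. -/

namespace IsWeaklyExtriangulated

variable {C : Type u} [Category.{v} C] [Preadditive C] {X : ExtData.{w} C}
  (hX : X.IsWeaklyExtriangulated)

include hX

lemma pull_eq_zero {Z A B : C} {δ : X.Ext Z A} {x : A ⟶ B} {y : B ⟶ Z}
    (h : X.IsTriangle δ x y) : X.pull y δ = 0 :=
  (hX.exact_right h y).2 ⟨𝟙 B, by simp⟩

lemma push_eq_zero {Z A B : C} {δ : X.Ext Z A} {x : A ⟶ B} {y : B ⟶ Z}
    (h : X.IsTriangle δ x y) : X.push x δ = 0 :=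
  (hX.coexact_right h x).2 ⟨𝟙 B, by simp⟩

/-- A morphism of triangles is invertible if its outer components are. -/
lemma isIso_mid {Z A B Z' A' B' : C} {δ : X.Ext Z A} {x : A ⟶ B} {y : B ⟶ Z}
    {δ' : X.Ext Z' A'} {x' : A' ⟶ B'} {y' : B' ⟶ Z'}
    (h : X.IsTriangle δ x y) (h' : X.IsTriangle δ' x' y')
    (a : A ⟶ A') (b : B ⟶ B') (c : Z ⟶ Z') [IsIso a] [IsIso c]
    (hx : x ≫ b = a ≫ x') (hy : b ≫ y' = y ≫ c) (hδ : X.push a δ = X.pull c δ') :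
    IsIso b := by
  have hδ₁ : δ = X.push (inv a) (X.pull c δ') := by
    rw [← hδ, push_push, IsIso.hom_inv_id, push_id]
  have hδ₂ : δ' = X.pull (inv c) (X.push a δ) := by
    rw [hδ, pull_pull, IsIso.inv_hom_id, pull_id]
  -- The sequences are too short for the five lemma, so one-sided inverses are built by hand. Here
  -- `g₀` inverts `b` up to a map killed by `y'`, which factors through `x'` and is corrected by
  -- `k`; `f₀` and `m` play the dual roles.
  obtain ⟨g₀, hg₀⟩ := (hX.exact_right h (y' ≫ inv c)).1 (by
    rw [hδ₁, ← push_pull_comm, pull_pull, Category.assoc, IsIso.inv_hom_id, Category.comp_id,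
      hX.pull_eq_zero h', map_zero])
  obtain ⟨k, hk⟩ := (hX.exact_mid h' (𝟙 B' - g₀ ≫ b)).1 (by
    rw [Preadditive.sub_comp, Category.assoc, hy, reassoc_of% hg₀]; simp)
  obtain ⟨f₀, hf₀⟩ := (hX.coexact_right h' (inv a ≫ x)).1 (by
    rw [hδ₂, push_pull_comm, push_push, IsIso.hom_inv_id_assoc, hX.push_eq_zero h, map_zero])
  obtain ⟨m, hm⟩ := (hX.coexact_mid h (𝟙 B - b ≫ f₀)).1 (by
    rw [Preadditive.comp_sub, reassoc_of% hx, hf₀]; simp)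
  have hr : (g₀ + k ≫ inv a ≫ x) ≫ b = 𝟙 B' := by
    simp only [Preadditive.add_comp, Category.assoc, hx, IsIso.inv_hom_id_assoc, hk]
    abel
  have hl : b ≫ (f₀ + y' ≫ inv c ≫ m) = 𝟙 B := by
    simp only [Preadditive.comp_add, reassoc_of% hy, IsIso.hom_inv_id_assoc, hm]
    abel
  have := IsSplitEpi.mk' ⟨_, hr⟩
  have := IsSplitMono.mk' ⟨_, hl⟩
  exact isIso_of_mono_of_isSplitEpi b

/-- Triangles are stable under isomorphisms of the outer terms. -/
lemma triangle_of_iso {Z A B Z' A' B' : C} {δ : X.Ext Z A} {x : A ⟶ B} {y : B ⟶ Z}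
    (h : X.IsTriangle δ x y) (a : A ≅ A') (b : B ≅ B') (c : Z ≅ Z') {x' : A' ⟶ B'} {y' : B' ⟶ Z'}
    (hx : x ≫ b.hom = a.hom ≫ x') (hy : b.hom ≫ y' = y ≫ c.hom) :
    X.IsTriangle (X.act c.inv a.hom δ) x' y' := by
  -- The transport is split into a pushforward realized by `B₁` and a pullback realized by `B₂`.
  -- Both comparison maps are invertible, so the given sequence is equivalent to the one through
  -- `B₂`.
  obtain ⟨B₁, x₁, y₁, h₁⟩ := hX.exists_triangle (X.push a.hom δ)
  obtain ⟨B₂, x₂, y₂, h₂⟩ := hX.exists_triangle (X.act c.inv a.hom δ)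
  obtain ⟨b₁, hb₁, hb₁', -⟩ := hX.good_lift_push a.hom h h₁
  obtain ⟨b₂, hb₂, hb₂', -⟩ := hX.good_lift_pull c.inv h₁
    (x' := x₂) (y' := y₂) (by rwa [← act_eq_pull_push])
  have : IsIso b₁ := hX.isIso_mid h h₁ a.hom b₁ (𝟙 Z) hb₁ (by simpa using hb₁') (by simp)
  have : IsIso b₂ := hX.isIso_mid h₂ h₁ (𝟙 A') b₂ c.inv (by simpa using hb₂) hb₂'
    (by rw [act_eq_pull_push, push_id])
  refine (hX.triangle_iff h₂ x' y').2 ⟨asIso b₂ ≪≫ (asIso b₁).symm ≪≫ b, ?_, ?_⟩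
  · rw [← cancel_epi a.hom, ← hx]
    simp [reassoc_of% hb₂, ← reassoc_of% hb₁]
  · have e : inv b₁ ≫ y = y₁ := by simp [← hb₁']
    simp [hy, reassoc_of% e, reassoc_of% hb₂']

end IsWeaklyExtriangulated

/-- An exact functor to a weakly extriangulated category identifies, up to a common roof of
morphisms which it inverts, the triangles realizing `δ` and `E(v, u)(δ)`, when it inverts `v`
and `u`. -/
lemma exists_roof {C : Type u} [Category.{v} C] [Preadditive C] {X : ExtData.{w} C}
    (hX : X.IsWeaklyExtriangulated) {D : Type u₁} [Category.{v₁} D] [Preadditive D]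
    {Y : ExtData.{w₁} D} (hY : Y.IsWeaklyExtriangulated) {F : ExtFunctor X Y} (hF : F.IsExact)
    {Z A B Z' A' B' : C} {δ : X.Ext Z A} {x : A ⟶ B} {y : B ⟶ Z} (h : X.IsTriangle δ x y)
    (v : Z' ⟶ Z) (u : A ⟶ A') [IsIso (F.functor.map v)] [IsIso (F.functor.map u)]
    {x' : A' ⟶ B'} {y' : B' ⟶ Z'} (h' : X.IsTriangle (X.act v u δ) x' y') :
    ∃ (B'' : C) (b : B ⟶ B'') (b' : B' ⟶ B'') (y'' : B'' ⟶ Z),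
      IsIso (F.functor.map b) ∧ IsIso (F.functor.map b') ∧
      x ≫ b = u ≫ x' ≫ b' ∧ b ≫ y'' = y ∧ b' ≫ y'' = y' ≫ v := by
  -- The apex realizes `u_* δ`, to which both `B` and `B'` map. `F` turns each of these maps into a
  -- morphism of triangles with invertible ends.
  obtain ⟨B₁, x₁, y₁, h₁⟩ := hX.exists_triangle (X.push u δ)
  obtain ⟨b₁, hb₁, hb₁', -⟩ := hX.good_lift_push u h h₁
  obtain ⟨b₂, hb₂, hb₂', -⟩ := hX.good_lift_pull v h₁
    (x' := x') (y' := y') (by rwa [← act_eq_pull_push])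
  refine ⟨B₁, b₁, b₂, y₁, ?_, ?_, ?_, hb₁', hb₂'⟩
  · refine hY.isIso_mid (hF.map_triangle h) (hF.map_triangle h₁) (F.functor.map u) _ (𝟙 _) ?_ ?_ ?_
    · rw [← F.functor.map_comp, hb₁, F.functor.map_comp]
    · rw [← F.functor.map_comp, hb₁', Category.comp_id]
    · simp [push, F.naturality]
  · refine hY.isIso_mid (hF.map_triangle h') (hF.map_triangle h₁) (𝟙 _) _ (F.functor.map v) ?_ ?_ ?_
    · rw [← F.functor.map_comp, hb₂, Category.id_comp]
    · rw [← F.functor.map_comp, hb₂', F.functor.map_comp]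
    · simp [push, pull, F.naturality]
  · rw [hb₁, hb₂]

/-! ### The Kan extension and the numerator of an extension. -/

noncomputable section

variable {C : Type u} [SmallCategory C] (X : ExtData.{u} C) {S : MorphismProperty C}

variable (S) in
/-- The homomorphism `μ`, with values in the groups of extensions of the localization. -/
def unitExt (Z A : C) : X.Ext Z A →+ (X.localization S).Ext (S.Q.obj Z) (S.Q.obj A) :=
  X.locμ S Z A

lemma unitExt_act {Z Z' A A' : C} (c : Z' ⟶ Z) (a : A ⟶ A') (δ : X.Ext Z A) :
    X.unitExt S Z' A' (X.act c a δ) =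
      (X.localization S).act (S.Q.map c) (S.Q.map a) (X.unitExt S Z A δ) :=
  (X.locQ S).naturality c a δ

lemma frac_eq_act {A V Z K : C} (t : Z ⟶ K) (ht : S t) (δ : X.Ext Z V) (s : A ⟶ V) (hs : S s) :
    X.frac t ht δ s hs =
      (X.localization S).act (locIso t ht).inv (locIso s hs).inv (X.unitExt S Z V δ) :=
  rfl

lemma frac_comp {A V Z K V' Z' : C} (t : Z ⟶ K) (ht : S t) (δ : X.Ext Z V) (s : A ⟶ V) (hs : S s)
    (v : Z' ⟶ Z) (u : V ⟶ V') (hvt : S (v ≫ t)) (hsu : S (s ≫ u)) :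
    X.frac (v ≫ t) hvt (X.act v u δ) (s ≫ u) hsu = X.frac t ht δ s hs := by
  rw [frac_eq_act, frac_eq_act, unitExt_act, act_act]
  congr 2
  · rw [Iso.inv_comp_eq]
    exact ((S.Q.map_comp v t =≫ _).trans (by
      rw [Category.assoc]
      exact (S.Q.map v ≫= (locIso t ht).hom_inv_id).trans (Category.comp_id _))).symm
  · rw [Iso.comp_inv_eq]
    exact (((locIso s hs).inv ≫= S.Q.map_comp s u).trans
      ((locIso s hs).inv_hom_id_assoc (S.Q.map u))).symm

instance : (X.locE S).IsLeftKanExtension ((S.Q.op.prod S.Q).leftKanExtensionUnit X.E) :=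
  inferInstanceAs (((S.Q.op.prod S.Q).leftKanExtension X.E).IsLeftKanExtension _)

variable {LL RR : S.Localization ⥤ C} (adjL : LL ⊣ S.Q) (adjR : S.Q ⊣ RR)

/-- The canonical map `Ẽ(K, A) → E(LL K, RR A)` when `LL ⊣ Q ⊣ RR`. -/
def numeratorTrans : X.locE S ⟶ LL.op.prod RR ⋙ X.E :=
  (X.locE S).descOfIsLeftKanExtension ((S.Q.op.prod S.Q).leftKanExtensionUnit X.E) _
    { app p := X.E.map (Prod.mkHom (adjL.counit.app p.1.unop).op (adjR.unit.app p.2))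
      naturality p q f := by
        dsimp
        rw [← X.E.map_comp, ← X.E.map_comp]
        congr 1
        ext
        · exact Quiver.Hom.unop_inj (adjL.counit.naturality f.1.unop).symm
        · exact (adjR.unit.naturality f.2) }

/-- The canonical homomorphism `Ẽ(K, A) → E(LL K, RR A)` when `LL ⊣ Q ⊣ RR`. -/
def numerator (K A : S.Localization) :
    (X.localization S).Ext K A →+ X.Ext (LL.obj K) (RR.obj A) :=
  ((X.numeratorTrans adjL adjR).app (op K, A)).hom

lemma numerator_act {K K' A A' : S.Localization} (c : K' ⟶ K) (a : A ⟶ A')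
    (ε : (X.localization S).Ext K A) :
    X.numerator adjL adjR K' A' ((X.localization S).act c a ε) =
      X.act (LL.map c) (RR.map a) (X.numerator adjL adjR K A ε) :=
  ConcreteCategory.congr_hom ((X.numeratorTrans adjL adjR).naturality (Prod.mkHom c.op a)) ε

lemma numerator_unitExt {Z A : C} (δ : X.Ext Z A) :
    X.numerator adjL adjR (S.Q.obj Z) (S.Q.obj A) (X.unitExt S Z A δ) =
      X.act (adjL.counit.app Z) (adjR.unit.app A) δ :=
  ConcreteCategory.congr_hom ((X.locE S).descOfIsLeftKanExtension_fac_app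
    ((S.Q.op.prod S.Q).leftKanExtensionUnit X.E) _ _ (op Z, A)) δ

/-- The inverse of `numeratorTrans`. -/
def numeratorTransInv : LL.op.prod RR ⋙ X.E ⟶ X.locE S where
  app p := AddCommGrpCat.ofHom
    (((X.localization S).act (adjL.unit.app p.1.unop) (adjR.counit.app p.2)).comp
      (X.unitExt S (LL.obj p.1.unop) (RR.obj p.2)))
  naturality p q f := by
    ext δ
    change (X.localization S).act _ _ (X.unitExt S _ _ (X.act (LL.map f.1.unop) (RR.map f.2) δ)) =
      (X.localization S).act f.1.unop f.2 ((X.localization S).act _ _ _)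
    rw [unitExt_act, act_act, act_act]
    congr 2
    · exact (adjL.unit.naturality f.1.unop).symm
    · exact (adjR.counit.naturality f.2)

/-- By the universal property of the Kan extension it suffices to test on the image of `μ`, where
the triangle identities of the two adjunctions apply. It follows that numerators determine
extensions. -/
lemma act_unitExt_numerator {K A : S.Localization} (ε : (X.localization S).Ext K A) :
    (X.localization S).act (adjL.unit.app K) (adjR.counit.app A)
      (X.unitExt S _ _ (X.numerator adjL adjR K A ε)) = ε := by
  have h : X.numeratorTrans adjL adjR ≫ X.numeratorTransInv adjL adjR = 𝟙 _ := by
    apply (X.locE S).hom_ext_of_isLeftKanExtension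
      ((S.Q.op.prod S.Q).leftKanExtensionUnit X.E)
    ext p δ
    change (X.localization S).act _ _ (X.unitExt S _ _ (X.numerator adjL adjR _ _
      (X.unitExt S p.1.unop p.2 δ))) = X.unitExt S p.1.unop p.2 δ
    rw [numerator_unitExt, unitExt_act]
    refine (act_act _ _ _ _ _ _).trans (Eq.trans ?_ (act_id _ _))
    congr 2
    · exact adjL.right_triangle_components _
    · exact adjR.left_triangle_components _
  exact ConcreteCategory.congr_hom (NatTrans.congr_app h (op K, A)) ε

end

/-! ### Triangles of the localization in terms of numerators. -/

section

variable {C : Type u} [SmallCategory C] [Preadditive C] {X : ExtData.{u} C}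
  {S : MorphismProperty C}

-- Unpacks the inductive definition with arbitrary objects and isomorphisms, so that every triangle
-- is visibly isomorphic to the image of one from `C`.
omit [Preadditive C] in
lemma exists_unitExt_of_locTriangle {A B K : S.Localization} {ε : (X.localization S).Ext K A}
    {x : A ⟶ B} {y : B ⟶ K} (h : (X.localization S).IsTriangle ε x y) :
    ∃ (V Y Z : C) (δ : X.Ext Z V) (x₀ : V ⟶ Y) (y₀ : Y ⟶ Z) (a : A ≅ S.Q.obj V)
      (b : B ≅ S.Q.obj Y) (c : K ≅ S.Q.obj Z), X.IsTriangle δ x₀ y₀ ∧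
      x ≫ b.hom = a.hom ≫ S.Q.map x₀ ∧ b.hom ≫ S.Q.map y₀ = y ≫ c.hom ∧
      ε = (X.localization S).act c.hom a.inv (X.unitExt S Z V δ) := by
  obtain ⟨t, ht, s, hs, δ, x₀, y₀, h, b⟩ := h
  refine ⟨_, _, _, δ, x₀, y₀, locIso s hs, b.symm, (locIso t ht).symm, h, ?_, ?_, rfl⟩
  · simp [locIso]
  · have : IsIso (S.Q.map t) := S.Q_inverts t ht
    simp [locIso]

variable {D : Type u₁} [Category.{v₁} D] [Preadditive D] {Y : ExtData.{w₁} D}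

/-- A factorization of an exact functor through the localization is exact. -/
lemma isExact_of_comp [S.HasLeftCalculusOfFractions] (hY : Y.IsWeaklyExtriangulated)
    {G : ExtFunctor (X.localization S) Y} (hG : ((X.locQ S).comp G).IsExact) : G.IsExact where
  additive := by
    have : (S.Q ⋙ G.functor).Additive := hG.additive
    exact (Localization.functor_additive_iff S.Q S G.functor).2 this
  map_triangle {A B Z ε x y} h := by
    obtain ⟨V, Y₀, Z₀, δ, x₀, y₀, a, b, c, h₀, hx, hy, rfl⟩ := exists_unitExt_of_locTriangle h
    rw [G.naturality]
    refine hY.triangle_of_iso (hG.map_triangle h₀) (G.functor.mapIso a.symm)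
      (G.functor.mapIso b.symm) (G.functor.mapIso c.symm) ?_ ?_
    · change G.functor.map (S.Q.map x₀) ≫ G.functor.map b.inv =
        G.functor.map a.inv ≫ G.functor.map x
      rw [← G.functor.map_comp, ← G.functor.map_comp]
      exact congrArg G.functor.map ((Iso.comp_inv_eq _).2
        ((Category.assoc _ _ _).trans ((Iso.eq_inv_comp _).2 hx.symm).symm).symm)
    · change G.functor.map b.inv ≫ G.functor.map y =
        G.functor.map (S.Q.map y₀) ≫ G.functor.map c.inv
      rw [← G.functor.map_comp, ← G.functor.map_comp]
      exact congrArg G.functor.map ((Iso.inv_comp_eq _).2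
        (((Iso.eq_comp_inv _).2 hy.symm).trans (Category.assoc _ _ _)))

/-- The two legs of the roof are inverted in `D`; a fully faithful `G` reflects isomorphisms, so `Q`
inverts them as well. -/
lemma exists_iso_of_act (hX : X.IsWeaklyExtriangulated) (hY : Y.IsWeaklyExtriangulated)
    {G : ExtFunctor (X.localization S) Y} [G.functor.Full] [G.functor.Faithful]
    (hG : ((X.locQ S).comp G).IsExact)
    {Z A B Z' A' B' : C} {δ : X.Ext Z A} {x : A ⟶ B} {y : B ⟶ Z} (h : X.IsTriangle δ x y)
    (v : Z' ⟶ Z) (u : A ⟶ A') [IsIso (S.Q.map v)] [IsIso (S.Q.map u)]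
    {x' : A' ⟶ B'} {y' : B' ⟶ Z'} (h' : X.IsTriangle (X.act v u δ) x' y') :
    ∃ b : S.Q.obj B ≅ S.Q.obj B', S.Q.map x ≫ b.hom = S.Q.map u ≫ S.Q.map x' ∧
      b.hom ≫ S.Q.map y' ≫ S.Q.map v = S.Q.map y := by
  have : IsIso (((X.locQ S).comp G).functor.map v) :=
    inferInstanceAs (IsIso (G.functor.map (S.Q.map v)))
  have : IsIso (((X.locQ S).comp G).functor.map u) :=
    inferInstanceAs (IsIso (G.functor.map (S.Q.map u)))
  obtain ⟨B'', b, b', y'', hb, hb', h₁, h₂, h₃⟩ := exists_roof hX hY hG h v u h'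
  have : IsIso (S.Q.map b) := by
    have : IsIso (G.functor.map (S.Q.map b)) := hb
    exact isIso_of_reflects_iso _ G.functor
  have : IsIso (S.Q.map b') := by
    have : IsIso (G.functor.map (S.Q.map b')) := hb'
    exact isIso_of_reflects_iso _ G.functor
  refine ⟨asIso (S.Q.map b) ≪≫ (asIso (S.Q.map b')).symm, ?_, ?_⟩
  · simp only [Iso.trans_hom, asIso_hom, Iso.symm_hom, asIso_inv]
    rw [← Category.assoc, IsIso.comp_inv_eq, ← S.Q.map_comp, ← S.Q.map_comp, ← S.Q.map_comp, h₁,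
      Category.assoc]
  · simp only [Iso.trans_hom, asIso_hom, Iso.symm_hom, asIso_inv, Category.assoc]
    rw [← S.Q.map_comp, ← h₃, S.Q.map_comp, IsIso.inv_hom_id_assoc, ← S.Q.map_comp, h₂]

variable {LL RR : S.Localization ⥤ C} (adjL : LL ⊣ S.Q) (adjR : S.Q ⊣ RR)
  [LL.Full] [LL.Faithful] [RR.Full] [RR.Faithful]

/-- The numerator is obtained from `δ` by acting with two morphisms of `C`. `Q` inverts both,
because full faithfulness of `LL` and `RR` makes the unit of `adjL` and the counit of `adjR`
invertible. -/
lemma exists_iso_numerator_of_iso (hX : X.IsWeaklyExtriangulated) (hY : Y.IsWeaklyExtriangulated)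
    {G : ExtFunctor (X.localization S) Y} [G.functor.Full] [G.functor.Faithful]
    (hG : ((X.locQ S).comp G).IsExact)
    {A B K : S.Localization} {V Y₀ Z : C} {δ : X.Ext Z V} {x₀ : V ⟶ Y₀} {y₀ : Y₀ ⟶ Z}
    (h₀ : X.IsTriangle δ x₀ y₀) (a : A ≅ S.Q.obj V) (b : B ≅ S.Q.obj Y₀) (c : K ≅ S.Q.obj Z)
    {x : A ⟶ B} {y : B ⟶ K} (hx : x ≫ b.hom = a.hom ≫ S.Q.map x₀)
    (hy : b.hom ≫ S.Q.map y₀ = y ≫ c.hom)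
    {Y' : C} {x' : RR.obj A ⟶ Y'} {y' : Y' ⟶ LL.obj K}
    (h' : X.IsTriangle (X.numerator adjL adjR K A
      ((X.localization S).act c.hom a.inv (X.unitExt S Z V δ))) x' y') :
    ∃ b' : B ≅ S.Q.obj Y', adjR.counit.app A ≫ x ≫ b'.hom = S.Q.map x' ∧
      b'.hom ≫ S.Q.map y' = y ≫ adjL.unit.app K := by
  rw [numerator_act, numerator_unitExt, act_act] at h'
  have hv : S.Q.map (LL.map c.hom ≫ adjL.counit.app Z) =
    inv (adjL.unit.app K) ≫ c.hom := by
    rw [IsIso.eq_inv_comp]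
    simp
  have hu : S.Q.map (adjR.unit.app V ≫ RR.map a.inv) = a.inv ≫ inv (adjR.counit.app A) := by
    rw [IsIso.eq_comp_inv]
    simp
  have : IsIso (S.Q.map (LL.map c.hom ≫ adjL.counit.app Z)) := by
    rw [hv]; infer_instance
  have : IsIso (S.Q.map (adjR.unit.app V ≫ RR.map a.inv)) := by
    rw [hu]; infer_instance
  obtain ⟨b₁, h₁, h₂⟩ := exists_iso_of_act hX hY hG h₀ _ _ h'
  refine ⟨b ≪≫ b₁, ?_, ?_⟩
  · rw [hu] at h₁
    simp [reassoc_of% hx, h₁]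
  · rw [hv] at h₂
    rw [Iso.trans_hom, Category.assoc, ← cancel_mono (inv (adjL.unit.app K) ≫ c.hom)]
    simp only [Category.assoc, IsIso.hom_inv_id_assoc]
    rw [← hy, ← h₂]

/-- The triangles in the localization, in terms of a realization of the numerator. -/
lemma exists_iso_numerator (hX : X.IsWeaklyExtriangulated) (hY : Y.IsWeaklyExtriangulated)
    {G : ExtFunctor (X.localization S) Y} [G.functor.Full] [G.functor.Faithful]
    (hG : ((X.locQ S).comp G).IsExact)
    {A B K : S.Localization} {ε : (X.localization S).Ext K A} {x : A ⟶ B} {y : B ⟶ K}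
    (h : (X.localization S).IsTriangle ε x y) {Y' : C} {x' : RR.obj A ⟶ Y'} {y' : Y' ⟶ LL.obj K}
    (h' : X.IsTriangle (X.numerator adjL adjR K A ε) x' y') :
    ∃ b' : B ≅ S.Q.obj Y', adjR.counit.app A ≫ x ≫ b'.hom = S.Q.map x' ∧
      b'.hom ≫ S.Q.map y' = y ≫ adjL.unit.app K := by
  obtain ⟨V, Y₀, Z, δ, x₀, y₀, a, b, c, h₀, hx, hy, rfl⟩ := exists_unitExt_of_locTriangle h
  exact exists_iso_numerator_of_iso adjL adjR hX hY hG h₀ a b c hx hy h'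

-- The canonical fraction: saturation `hS` puts its denominators in `S`, and the triangle identities
-- identify their inverses under `Q` with the unit of `adjL` and the counit of `adjR`.
omit [Preadditive C] in
lemma frac_numerator (hS : ∀ {A B : C} (f : A ⟶ B), IsIso (S.Q.map f) → S f) {K A : C}
    (ε : (X.localization S).Ext (S.Q.obj K) (S.Q.obj A)) :
    X.frac (adjL.counit.app K) (hS _ inferInstance) (X.numerator adjL adjR _ _ ε)
      (adjR.unit.app A) (hS _ inferInstance) = ε := by
  rw [frac_eq_act]
  refine Eq.trans ?_ (X.act_unitExt_numerator adjL adjR ε)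
  congr 2
  · exact ((Iso.comp_hom_eq_id _).1 (adjL.right_triangle_components K)).symm
  · exact ((Iso.hom_comp_eq_id _).1 (adjR.left_triangle_components A)).symm

omit [Preadditive C] in
lemma locTriangle_of_numerator_obj (hS : ∀ {A B : C} (f : A ⟶ B), IsIso (S.Q.map f) → S f)
    {A K : C} {B : S.Localization} {ε : (X.localization S).Ext (S.Q.obj K) (S.Q.obj A)}
    {x : S.Q.obj A ⟶ B} {y : B ⟶ S.Q.obj K}
    {Y' : C} {x' : RR.obj (S.Q.obj A) ⟶ Y'} {y' : Y' ⟶ LL.obj (S.Q.obj K)}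
    (h' : X.IsTriangle (X.numerator adjL adjR _ _ ε) x' y') (b' : B ≅ S.Q.obj Y')
    (hx : adjR.counit.app (S.Q.obj A) ≫ x ≫ b'.hom = S.Q.map x')
    (hy : b'.hom ≫ S.Q.map y' = y ≫ adjL.unit.app (S.Q.obj K)) :
    (X.localization S).IsTriangle ε x y := by
  have h := LocTriangle.mk (S := S) (adjL.counit.app K) (hS _ inferInstance) (adjR.unit.app A)
    (hS _ inferInstance) _ _ _ h' b'.symm
  have e₁ : x = S.Q.map (adjR.unit.app A ≫ x') ≫ b'.symm.hom := by
    rw [Iso.symm_hom, Iso.eq_comp_inv, S.Q.map_comp, ← hx]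
    exact (adjR.left_triangle_components_assoc A _).symm
  have e₂ : y = b'.symm.inv ≫ S.Q.map (y' ≫ adjL.counit.app K) := by
    rw [Iso.symm_inv, S.Q.map_comp, reassoc_of% hy]
    exact ((y ≫= adjL.right_triangle_components K).trans (Category.comp_id y)).symm
  rw [frac_numerator adjL adjR hS ε, ← e₁, ← e₂] at h
  exact h

-- Converse to `exists_iso_numerator`. Together they replace the choice of a fraction by a
-- realization of the numerator.
omit [Preadditive C] in
lemma locTriangle_of_numerator (hS : ∀ {A B : C} (f : A ⟶ B), IsIso (S.Q.map f) → S f)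
    {A B K : S.Localization} {ε : (X.localization S).Ext K A} {x : A ⟶ B} {y : B ⟶ K}
    {Y' : C} {x' : RR.obj A ⟶ Y'} {y' : Y' ⟶ LL.obj K}
    (h' : X.IsTriangle (X.numerator adjL adjR K A ε) x' y') (b' : B ≅ S.Q.obj Y')
    (hx : adjR.counit.app A ≫ x ≫ b'.hom = S.Q.map x')
    (hy : b'.hom ≫ S.Q.map y' = y ≫ adjL.unit.app K) :
    (X.localization S).IsTriangle ε x y := by
  obtain ⟨A, rfl⟩ := (Localization.Construction.objEquiv S).surjective A
  obtain ⟨K, rfl⟩ := (Localization.Construction.objEquiv S).surjective K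
  exact locTriangle_of_numerator_obj adjL adjR hS h' b' hx hy

/-- Used to produce triangles from `C` without naming denominators: the outer isomorphisms in the
localization need not come from morphisms of `S`. -/
lemma locTriangle_of_iso (hX : X.IsWeaklyExtriangulated) (hY : Y.IsWeaklyExtriangulated)
    {G : ExtFunctor (X.localization S) Y} [G.functor.Full] [G.functor.Faithful]
    (hG : ((X.locQ S).comp G).IsExact) (adjL : LL ⊣ S.Q) (adjR : S.Q ⊣ RR)
    (hS : ∀ {A B : C} (f : A ⟶ B), IsIso (S.Q.map f) → S f)
    {A B K : S.Localization} {ε : (X.localization S).Ext K A}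
    {V Y₀ Z : C} {δ : X.Ext Z V} {x₀ : V ⟶ Y₀} {y₀ : Y₀ ⟶ Z}
    (h₀ : X.IsTriangle δ x₀ y₀) (a : A ≅ S.Q.obj V) (b : B ≅ S.Q.obj Y₀) (c : K ≅ S.Q.obj Z)
    {x : A ⟶ B} {y : B ⟶ K} (hx : x ≫ b.hom = a.hom ≫ S.Q.map x₀)
    (hy : b.hom ≫ S.Q.map y₀ = y ≫ c.hom)
    (hε : (X.localization S).act c.hom a.inv (X.unitExt S Z V δ) = ε) :
    (X.localization S).IsTriangle ε x y := by
  subst hε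
  obtain ⟨Y', x', y', h'⟩ := hX.exists_triangle (X.numerator adjL adjR K A
      ((X.localization S).act c.hom a.inv (X.unitExt S Z V δ)))
  obtain ⟨b', h₁, h₂⟩ := exists_iso_numerator_of_iso adjL adjR hX hY hG h₀ a b c hx hy h'
  exact locTriangle_of_numerator adjL adjR hS h' b' h₁ h₂

end

/-! ### Fractions, and factorization of functors with their action on extensions. -/

section

variable {C : Type u} [SmallCategory C] {X : ExtData.{u} C} {S : MorphismProperty C}
  {LL RR : S.Localization ⥤ C} [LL.Full] [LL.Faithful] [RR.Full] [RR.Faithful]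

lemma isGivenByFractions (adjL : LL ⊣ S.Q) (adjR : S.Q ⊣ RR)
    (hS : ∀ {A B : C} (f : A ⟶ B), IsIso (S.Q.map f) → S f) [S.IsMultiplicative] :
    X.IsGivenByFractions S where
  exists_frac {A K} ε := ⟨_, _, _, _, _, _, _, (frac_numerator adjL adjR hS ε).symm⟩
  frac_eq_iff {A K Z₁ Z₂ V₁ V₂} t₁ ht₁ δ₁ s₁ hs₁ t₂ ht₂ δ₂ s₂ hs₂ := by
    constructor
    · intro h
      -- Every fraction refines to the canonical one, whose denominators depend only on `K` and `A`.
      -- The maps `v` and `u` are the adjuncts of `Q(t)⁻¹` and `Q(s)⁻¹`. Two equal fractions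
      -- therefore meet at their common numerator.
      have key : ∀ {Z V : C} (t : Z ⟶ K) (ht : S t) (δ : X.Ext Z V) (s : A ⟶ V) (hs : S s),
          ∃ (v : LL.obj (S.Q.obj K) ⟶ Z) (u : V ⟶ RR.obj (S.Q.obj A)), S v ∧ S u ∧
            v ≫ t = adjL.counit.app K ∧ s ≫ u = adjR.unit.app A ∧
            X.act v u δ = X.numerator adjL adjR _ _ (X.frac t ht δ s hs) := by
        intro Z V t ht δ s hs
        refine ⟨LL.map (locIso t ht).inv ≫ adjL.counit.app Z,
          adjR.unit.app V ≫ RR.map (locIso s hs).inv,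
          hS _ (by rw [S.Q.map_comp]; infer_instance),
          hS _ (by rw [S.Q.map_comp]; infer_instance), ?_, ?_, ?_⟩
        · rw [Category.assoc]
          have h₁ := adjL.counit.naturality t
          dsimp at h₁
          rw [← h₁, ← Category.assoc, ← LL.map_comp]
          have h₂ : (locIso t ht).inv ≫ S.Q.map t = 𝟙 _ := (locIso t ht).inv_hom_id
          rw [h₂, LL.map_id, Category.id_comp]
        · have h₁ := adjR.unit.naturality s
          dsimp at h₁
          rw [← Category.assoc, h₁, Category.assoc, ← RR.map_comp]
          have h₂ : S.Q.map s ≫ (locIso s hs).inv = 𝟙 _ := (locIso s hs).hom_inv_id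
          rw [h₂, RR.map_id, Category.comp_id]
        · rw [frac_eq_act, numerator_act, numerator_unitExt]
          exact (act_act _ _ _ _ _ _).symm
      obtain ⟨v₁, u₁, hv₁, hu₁, e₁, f₁, g₁⟩ := key t₁ ht₁ δ₁ s₁ hs₁
      obtain ⟨v₂, u₂, hv₂, hu₂, e₂, f₂, g₂⟩ := key t₂ ht₂ δ₂ s₂ hs₂
      exact ⟨_, _, v₁, v₂, u₁, u₂, hv₁, hv₂, hu₁, hu₂, e₁.trans e₂.symm, f₁.trans f₂.symm,
        by rw [g₁, g₂, h]⟩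
    · rintro ⟨Z, V, v₁, v₂, u₁, u₂, hv₁, hv₂, hu₁, hu₂, hv, hu, h⟩
      rw [← X.frac_comp t₁ ht₁ δ₁ s₁ hs₁ v₁ u₁ (S.comp_mem _ _ hv₁ ht₁) (S.comp_mem _ _ hs₁ hu₁),
        ← X.frac_comp t₂ ht₂ δ₂ s₂ hs₂ v₂ u₂ (S.comp_mem _ _ hv₂ ht₂) (S.comp_mem _ _ hs₂ hu₂)]
      congr 1

variable {D : Type u₁} [Category.{v₁} D] {Y : ExtData.{w₁} D}

-- Strict universality of `Q` settles the functors. The homomorphisms agree because every extension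
-- is obtained by acting on an element in the image of `μ`.
omit [LL.Full] [LL.Faithful] [RR.Full] [RR.Faithful] in
lemma extFunctor_ext (adjL : LL ⊣ S.Q) (adjR : S.Q ⊣ RR) (G G' : ExtFunctor (X.localization S) Y)
    (h : (X.locQ S).comp G = (X.locQ S).comp G') : G = G' := by
  obtain ⟨G, φ, hφ⟩ := G
  obtain ⟨G', φ', hφ'⟩ := G'
  obtain rfl : G = G' := Localization.Construction.uniq _ _ (congrArg ExtFunctor.functor h)
  obtain rfl : φ = φ' := by
    simp only [ExtFunctor.comp, ExtFunctor.mk.injEq, heq_eq_eq, true_and] at h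
    funext K A
    ext ε
    rw [← X.act_unitExt_numerator adjL adjR ε, hφ, hφ']
    congr 1
    exact DFunLike.congr_fun (congrFun (congrFun h _) _) _
  rfl

omit [LL.Full] [LL.Faithful] [RR.Full] [RR.Faithful] in
/-- Natural transformations of groups of extensions extend to the localization. -/
lemma exists_extFunctor (adjL : LL ⊣ S.Q) (adjR : S.Q ⊣ RR) (G : S.Localization ⥤ D)
    (F : ExtFunctor X Y) (hF : S.Q ⋙ G = F.functor) :
    ∃ G' : ExtFunctor (X.localization S) Y, G'.functor = G ∧ (X.locQ S).comp G' = F := by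
  obtain ⟨F, φ, hφ⟩ := F
  subst hF
  -- The formula is forced by naturality: write an extension as the action of the unit and counit on
  -- `μ` of its numerator, and apply `φ` to the numerator.
  refine ⟨
  { functor := G
    φ K A := ((Y.act (G.map (adjL.unit.app K)) (G.map (adjR.counit.app A))).comp
      (φ (LL.obj K) (RR.obj A))).comp (X.numerator adjL adjR K A)
    naturality {K K' A A'} c a ε := by
      change Y.act _ _ (φ _ _ (X.numerator adjL adjR _ _ ((X.localization S).act c a ε))) =
        Y.act _ _ (Y.act _ _ (φ _ _ (X.numerator adjL adjR _ _ ε)))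
      rw [numerator_act, hφ]
      refine (act_act _ _ _ _ _ _).trans ((act_act _ _ _ _ _ _).trans ?_).symm
      dsimp
      rw [← G.map_comp, ← G.map_comp, ← G.map_comp, ← G.map_comp]
      congr 3
      · exact (adjL.unit.naturality c)
      · exact (adjR.counit.naturality a).symm }, rfl, ?_⟩
  have h : ∀ (Z A : C) (δ : X.Ext Z A),
      Y.act (G.map (adjL.unit.app (S.Q.obj Z))) (G.map (adjR.counit.app (S.Q.obj A)))
        (φ _ _ (X.numerator adjL adjR _ _ (X.unitExt S Z A δ))) = φ Z A δ := by
    intro Z A δ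
    rw [numerator_unitExt, hφ]
    refine (act_act _ _ _ _ _ _).trans (Eq.trans ?_ (act_id _ _))
    dsimp
    rw [← G.map_comp, ← G.map_comp]
    congr 2
    · exact (congrArg G.map (adjL.right_triangle_components Z)).trans (G.map_id _)
    · exact (congrArg G.map (adjR.left_triangle_components A)).trans (G.map_id _)
  simp only [ExtFunctor.comp, ExtFunctor.mk.injEq]
  refine ⟨rfl, heq_of_eq ?_⟩
  funext Z A
  ext δ
  exact h Z A δ

end

/-! ### The axioms for the localization. -/

section

variable {C : Type u} [SmallCategory C] [Preadditive C] {X : ExtData.{u} C}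
  {S : MorphismProperty C} [S.HasLeftCalculusOfFractions]
  {D : Type u₁} [Category.{v₁} D] [Preadditive D] {Y : ExtData.{w₁} D}
  {LL RR : S.Localization ⥤ C} [LL.Full] [LL.Faithful] [RR.Full] [RR.Faithful]

lemma hasBinaryBiproducts_localization [HasBinaryBiproducts C] :
    HasBinaryBiproducts S.Localization where
  has_binary_biproduct A B := by
    obtain ⟨A, rfl⟩ := (Localization.Construction.objEquiv S).surjective A
    obtain ⟨B, rfl⟩ := (Localization.Construction.objEquiv S).surjective B
    have : PreservesBinaryBiproducts S.Q := preservesBinaryBiproducts_of_preservesBiproducts _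
    exact inferInstanceAs (HasBinaryBiproduct (S.Q.obj A) (S.Q.obj B))

lemma isWeaklyExtriangulated_localization
    (hX : X.IsWeaklyExtriangulated) (hY : Y.IsWeaklyExtriangulated)
    {G : ExtFunctor (X.localization S) Y} [G.functor.Full] [G.functor.Faithful]
    (hG : ((X.locQ S).comp G).IsExact) (adjL : LL ⊣ S.Q) (adjR : S.Q ⊣ RR)
    (hS : ∀ {A B : C} (f : A ⟶ B), IsIso (S.Q.map f) → S f) :
    (X.localization S).IsWeaklyExtriangulated := by
  have hG' := isExact_of_comp hY hG
  have := hG'.additive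
  have := hX.hasZeroObject
  obtain ⟨O₀, hO₀⟩ := this
  have : HasZeroObject C := ⟨O₀, hO₀⟩
  have := hX.hasBinaryBiproducts
  have : HasBinaryBiproducts S.Localization := hasBinaryBiproducts_localization
  have : PreservesBinaryBiproducts S.Q := preservesBinaryBiproducts_of_preservesBiproducts _
  have : LL.Additive := adjL.left_adjoint_additive
  have : RR.Additive := adjR.right_adjoint_additive
  have inj : ∀ {K A : S.Localization} {ε ε' : (X.localization S).Ext K A},
      X.numerator adjL adjR K A ε = X.numerator adjL adjR K A ε' → ε = ε' := fun {K A ε ε'} h ↦ by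
    rw [← X.act_unitExt_numerator adjL adjR ε, h, X.act_unitExt_numerator]
  refine
  { hasZeroObject := inferInstance
    hasBinaryBiproducts := inferInstance
    add_push a a' δ := ?_
    add_pull c c' δ := ?_
    exists_triangle {Z A} δ := ?_
    triangle_iff {Z A B B' δ x y} h x' y' := ?_
    exact_mid {Z A B δ x y} h W f := ?_
    exact_right {Z A B δ x y} h W f := ?_
    coexact_mid {Z A B δ x y} h W f := ?_
    coexact_right {Z A B δ x y} h W f := ?_
    triangle_id_zero A O hO := ?_
    triangle_zero_id A O hO := ?_
    good_lift_push {Z A A' B B' δ x y} a x' y' h h' := ?_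
    good_lift_pull {Z Z' A B B' δ x y} c x' y' h h' := ?_ }
  · apply inj
    have := hX.add_push (RR.map a) (RR.map a') (X.numerator adjL adjR _ _ δ)
    simpa [push, numerator_act, RR.map_add] using this
  · apply inj
    have := hX.add_pull (LL.map c) (LL.map c') (X.numerator adjL adjR _ _ δ)
    simpa [pull, numerator_act, LL.map_add] using this
  -- Realize the numerator in `C`, then correct the ends by the invertible counit and unit.
  · obtain ⟨B, x, y, h⟩ := hX.exists_triangle (X.numerator adjL adjR _ _ δ)
    exact ⟨S.Q.obj B, inv (adjR.counit.app A) ≫ S.Q.map x, S.Q.map y ≫ inv (adjL.unit.app Z),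
      locTriangle_of_numerator adjL adjR hS h (Iso.refl _) (by simp) (by simp)⟩
  · obtain ⟨B₀, x₀, y₀, h₀⟩ := hX.exists_triangle (X.numerator adjL adjR _ _ δ)
    obtain ⟨b, hb, hb'⟩ := exists_iso_numerator adjL adjR hX hY hG h h₀
    constructor
    · intro h'
      obtain ⟨b', hx, hy⟩ := exists_iso_numerator adjL adjR hX hY hG h' h₀
      refine ⟨b ≪≫ b'.symm, ?_, ?_⟩
      · rw [← cancel_epi (adjR.counit.app A), Iso.trans_hom, reassoc_of% hb, ← hx]
        simp
      · rw [← cancel_mono (adjL.unit.app Z), ← hb']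
        simp [← hy]
    · rintro ⟨b', hx, hy⟩
      refine locTriangle_of_numerator adjL adjR hS h₀ (b'.symm ≪≫ b) ?_ ?_
      · simp [← hx, hb]
      · simp [hb', ← hy]
  -- Exactness at the middle term holds in `D` and is reflected by the fully faithful `G`.
  · have hD := hG'.map_triangle h
    refine Iff.trans ?_ (Iff.trans (hY.exact_mid hD (G.functor.map f)) ?_)
    · rw [← G.functor.map_comp, G.functor.map_eq_zero_iff]
    · constructor
      · rintro ⟨g, hg⟩
        exact ⟨G.functor.preimage g, G.functor.map_injective (by simpa using hg)⟩
      · rintro ⟨g, rfl⟩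
        exact ⟨G.functor.map g, by simp⟩
  -- Only the lifting direction uses `D`, since `G` is not known to be injective on extensions. For
  -- the converse, the extension pulls back to zero along its own deflation already in `C`.
  · have hD := hG'.map_triangle h
    constructor
    · intro hf
      obtain ⟨g, hg⟩ := (hY.exact_right hD (G.functor.map f)).1 (by
        have := G.naturality f (𝟙 A) δ
        rw [G.functor.map_id] at this
        exact this.symm.trans ((congrArg _ hf).trans (map_zero _)))
      exact ⟨G.functor.preimage g, G.functor.map_injective (by simpa using hg)⟩
    · rintro ⟨g, rfl⟩
      obtain ⟨V, Y₀, Z₀, δ, x₀, y₀, a, b, c, h₀, hx, hy, rfl⟩ := exists_unitExt_of_locTriangle h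
      have : X.act y₀ (𝟙 V) δ = 0 := hX.pull_eq_zero h₀
      rw [pull, act_act, Category.assoc, ← hy]
      have e := congrArg ((X.localization S).act (g ≫ b.hom) a.inv)
        (X.unitExt_act (S := S) y₀ (𝟙 V) δ)
      rw [this] at e
      simpa using e.symm
  · have hD := hG'.map_triangle h
    refine Iff.trans ?_ (Iff.trans (hY.coexact_mid hD (G.functor.map f)) ?_)
    · rw [← G.functor.map_comp, G.functor.map_eq_zero_iff]
    · constructor
      · rintro ⟨g, hg⟩
        exact ⟨G.functor.preimage g, G.functor.map_injective (by simpa using hg)⟩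
      · rintro ⟨g, rfl⟩
        exact ⟨G.functor.map g, by simp⟩
  · have hD := hG'.map_triangle h
    constructor
    · intro hf
      obtain ⟨g, hg⟩ := (hY.coexact_right hD (G.functor.map f)).1 (by
        have := G.naturality (𝟙 Z) f δ
        rw [G.functor.map_id] at this
        exact this.symm.trans ((congrArg _ hf).trans (map_zero _)))
      exact ⟨G.functor.preimage g, G.functor.map_injective (by simpa using hg)⟩
    · rintro ⟨g, rfl⟩
      obtain ⟨V, Y₀, Z₀, δ, x₀, y₀, a, b, c, h₀, hx, hy, rfl⟩ := exists_unitExt_of_locTriangle h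
      have : X.act (𝟙 Z₀) x₀ δ = 0 := hX.push_eq_zero h₀
      have hx' : a.inv ≫ x = S.Q.map x₀ ≫ b.inv := by
        rw [Iso.eq_comp_inv, Category.assoc, hx, Iso.inv_hom_id_assoc]
      rw [push, act_act, reassoc_of% hx']
      have e := congrArg ((X.localization S).act c.hom (b.inv ≫ g))
        (X.unitExt_act (S := S) (𝟙 Z₀) x₀ δ)
      rw [this] at e
      simpa using e.symm
  · obtain ⟨A, rfl⟩ := (Localization.Construction.objEquiv S).surjective A
    -- The zero object `O` need not be `Q` of a zero object of `C`, so it is compared with the image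
    -- of `O₀`.
    refine locTriangle_of_iso hX hY hG adjL adjR hS
      (hX.triangle_id_zero A O₀ hO₀) (Iso.refl (S.Q.obj A)) (Iso.refl (S.Q.obj A))
      (hO.iso (S.Q.map_isZero hO₀)) ?_ ?_ ?_
    · exact (Category.comp_id _).trans ((S.Q.map_id A).symm.trans (Category.id_comp _).symm)
    · exact (S.Q.map_isZero hO₀).eq_of_tgt _ _
    · rw [map_zero, map_zero]; rfl
  · obtain ⟨A, rfl⟩ := (Localization.Construction.objEquiv S).surjective A
    refine locTriangle_of_iso hX hY hG adjL adjR hS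
      (hX.triangle_zero_id A O₀ hO₀)
      (hO.iso (S.Q.map_isZero hO₀)) (Iso.refl (S.Q.obj A)) (Iso.refl (S.Q.obj A)) ?_ ?_ ?_
    · exact hO.eq_of_src _ _
    · exact (Category.id_comp _).trans ((S.Q.map_id A).trans (Category.comp_id _).symm)
    · rw [map_zero, map_zero]; rfl
  · obtain ⟨B₀, x₀, y₀, h₀⟩ := hX.exists_triangle (X.numerator adjL adjR _ _ δ)
    obtain ⟨B₁, x₁, y₁, h₁⟩ :=
      hX.exists_triangle (X.push (RR.map a) (X.numerator adjL adjR _ _ δ))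
    obtain ⟨b₀, hb₀, hb₀'⟩ := exists_iso_numerator adjL adjR hX hY hG h h₀
    obtain ⟨b₁, hb₁, hb₁'⟩ := exists_iso_numerator adjL adjR hX hY hG h'
      (x' := x₁) (y' := y₁) (by simpa [push, numerator_act] using h₁)
    -- The good lift is taken in `C` between realizations of the numerators and conjugated by `b₀`
    -- and `b₁`. Its cone is carried over using that `Q` preserves biproducts.
    obtain ⟨b, hxb, hby, hb⟩ := hX.good_lift_push (RR.map a) h₀ h₁
    have eA := adjR.counit.naturality a
    dsimp at eA
    refine ⟨b₀.hom ≫ S.Q.map b ≫ b₁.inv, ?_, ?_, ?_⟩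
    · rw [← cancel_epi (adjR.counit.app A), reassoc_of% hb₀, ← S.Q.map_comp_assoc, hxb,
        S.Q.map_comp, Category.assoc, ← hb₁, ← reassoc_of% eA]
      simp
    · rw [← cancel_mono (adjL.unit.app Z), ← hb₀', ← hby]
      simp [← hb₁']
    · refine locTriangle_of_iso hX hY hG adjL adjR hS hb (asIso (adjR.counit.app A)).symm
        (biprod.mapIso b₀ (asIso (adjR.counit.app A')).symm ≪≫ (S.Q.mapBiprod _ _).symm) b₁ ?_ ?_ ?_
      · rw [Iso.trans_hom, Iso.symm_hom, Iso.symm_hom, asIso_inv, IsIso.eq_inv_comp,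
          ← biprod.lift_mapBiprod, ← hb₀]
        simp only [← Category.assoc]
        congr 1
        ext
        · simp
        · simp [← reassoc_of% eA]
      · rw [← cancel_epi (biprod.mapIso b₀ (asIso (adjR.counit.app A')).symm ≪≫
            (S.Q.mapBiprod _ _).symm).inv, Iso.inv_hom_id_assoc]
        have e : S.Q.map (biprod.desc b (-x₁)) = (S.Q.mapBiprod B₀ (RR.obj A')).hom ≫
            biprod.desc (S.Q.map b) (S.Q.map (-x₁)) := by
          rw [← biprod.mapBiprod_inv_map_desc, Iso.hom_inv_id_assoc]
        rw [e]
        simp only [Iso.trans_inv, Iso.symm_inv, Category.assoc]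
        congr 1
        ext
        · simp
        · simp [← hb₁]
      · rw [pull, unitExt_act, act_act]
        conv_rhs => rw [← X.act_unitExt_numerator adjL adjR δ, pull, act_act]
        rw [← hb₁']
        simp
  · obtain ⟨B₀, x₀, y₀, h₀⟩ := hX.exists_triangle (X.numerator adjL adjR _ _ δ)
    obtain ⟨B₁, x₁, y₁, h₁⟩ :=
      hX.exists_triangle (X.pull (LL.map c) (X.numerator adjL adjR _ _ δ))
    obtain ⟨b₀, hb₀, hb₀'⟩ := exists_iso_numerator adjL adjR hX hY hG h h₀
    obtain ⟨b₁, hb₁, hb₁'⟩ := exists_iso_numerator adjL adjR hX hY hG h'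
      (x' := x₁) (y' := y₁) (by simpa [pull, numerator_act] using h₁)
    -- Dual construction: `LL` and the unit of `adjL` take over the roles of `RR` and the counit of
    -- `adjR`.
    obtain ⟨b, hxb, hby, hb⟩ := hX.good_lift_pull (LL.map c) h₀ h₁
    have eZ := adjL.unit.naturality c
    dsimp at eZ
    refine ⟨b₁.hom ≫ S.Q.map b ≫ b₀.inv, ?_, ?_, ?_⟩
    · rw [← cancel_epi (adjR.counit.app A), reassoc_of% hb₁, ← S.Q.map_comp_assoc, hxb, ← hb₀]
      simp
    · rw [← cancel_mono (adjL.unit.app Z)]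
      simp only [Category.assoc]
      rw [← hb₀', Iso.inv_hom_id_assoc, ← S.Q.map_comp, hby, S.Q.map_comp, reassoc_of% hb₁', ← eZ]
    · refine locTriangle_of_iso hX hY hG adjL adjR hS hb b₁
        (biprod.mapIso (asIso (adjL.unit.app Z')) b₀ ≪≫ (S.Q.mapBiprod _ _).symm)
        (asIso (adjL.unit.app Z)) ?_ ?_ ?_
      · rw [Iso.trans_hom, Iso.symm_hom, ← biprod.lift_mapBiprod]
        simp only [← Category.assoc]
        congr 1
        ext
        · simp [hb₁']
        · simp
      · rw [← cancel_epi (biprod.mapIso (asIso (adjL.unit.app Z')) b₀ ≪≫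
            (S.Q.mapBiprod _ _).symm).inv, Iso.inv_hom_id_assoc]
        have e : S.Q.map (biprod.desc (LL.map c) y₀) = (S.Q.mapBiprod (LL.obj Z') B₀).hom ≫
            biprod.desc (S.Q.map (LL.map c)) (S.Q.map y₀) := by
          rw [← biprod.mapBiprod_inv_map_desc, Iso.hom_inv_id_assoc]
        rw [e]
        simp only [Iso.trans_inv, Iso.symm_inv, Category.assoc]
        congr 1
        ext
        · simp
        · have e' : b₀.inv ≫ y ≫ adjL.unit.app Z = S.Q.map y₀ := by
            rw [← hb₀', Iso.inv_hom_id_assoc]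
          simp [e']
      · rw [push, unitExt_act, act_act]
        conv_rhs => rw [← X.act_unitExt_numerator adjL adjR δ, push, act_act]
        have e : S.Q.map x₁ ≫ b₁.inv = adjR.counit.app A ≫ x' := by
          rw [Iso.comp_inv_eq, ← hb₁, Category.assoc]
        rw [e]
        simp

lemma isExact_locQ (hX : X.IsWeaklyExtriangulated) (hY : Y.IsWeaklyExtriangulated)
    {G : ExtFunctor (X.localization S) Y} [G.functor.Full] [G.functor.Faithful]
    (hG : ((X.locQ S).comp G).IsExact) (adjL : LL ⊣ S.Q) (adjR : S.Q ⊣ RR)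
    (hS : ∀ {A B : C} (f : A ⟶ B), IsIso (S.Q.map f) → S f) :
    (X.locQ S).IsExact where
  additive := inferInstanceAs S.Q.Additive
  map_triangle {A B Z _ _ _} h :=
    locTriangle_of_iso hX hY hG adjL adjR hS h (Iso.refl (S.Q.obj A)) (Iso.refl (S.Q.obj B))
      (Iso.refl (S.Q.obj Z)) ((Category.comp_id _).trans (Category.id_comp _).symm)
      ((Category.id_comp _).trans (Category.comp_id _).symm) (act_id _ _)

end

end ExtData

/-! ### The main theorem. -/

theorem corollary3p7 {C : Type u} [SmallCategory C] [Preadditive C]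
    {D : Type u₁} [Category.{v₁} D] [Preadditive D]
    (X : ExtData.{u} C) (hX : X.IsExtriangulated)
    (Y : ExtData.{w} D) (hY : Y.IsWeaklyExtriangulated)
    (F : ExtFunctor X Y) (hF : F.IsExact)
    (L R : D ⥤ C) (adjL : L ⊣ F.functor) (adjR : F.functor ⊣ R)
    (hLfull : L.Full) (hLfaithful : L.Faithful) (hRfull : R.Full) (hRfaithful : R.Faithful)
    (S : MorphismProperty C)
    (hS : S = (MorphismProperty.isomorphisms D).inverseImage F.functor) :
    -- the set `S` is a multiplicative system, which makes the localization preadditive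
    ∃ (_ : S.HasLeftCalculusOfFractions) (_ : S.HasRightCalculusOfFractions),
      -- the localization is weakly extriangulated, and `(Q, μ)` is an exact functor to it
      X.IsGivenByFractions S ∧
      (X.localization S).IsWeaklyExtriangulated ∧
      (X.locQ S).IsExact ∧
      -- unique exact factorization, by an equivalence
      (∃! G : ExtFunctor (X.localization S) Y, G.IsExact ∧ (X.locQ S).comp G = F) ∧
      ∀ G : ExtFunctor (X.localization S) Y,
        G.IsExact → (X.locQ S).comp G = F → G.functor.IsEquivalence := by
  -- The fully faithful right adjoint gives the left calculus and the localization property; the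
  -- fully faithful left adjoint gives the right calculus.
  have hLC : S.HasLeftCalculusOfFractions := hS ▸ adjR.hasLeftCalculusOfFractions'
  have hRC : S.HasRightCalculusOfFractions := hS ▸ adjL.hasRightCalculusOfFractions'
  have hloc : F.functor.IsLocalization S := hS ▸ adjR.isLocalization_leftAdjoint'
  refine ⟨hLC, hRC, ?_⟩
  have hequiv : ∀ G : S.Localization ⥤ D, S.Q ⋙ G = F.functor → G.IsEquivalence := by
    intro G hG
    have := hloc.isEquivalence
    rwa [Localization.Construction.uniq G (Localization.Construction.lift F.functor hloc.inverts)
      (hG.trans (Localization.Construction.fac F.functor hloc.inverts).symm)]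
  let G₀ := Localization.Construction.lift F.functor hloc.inverts
  have hG₀ : S.Q ⋙ G₀ = F.functor := Localization.Construction.fac F.functor hloc.inverts
  have := hequiv G₀ hG₀
  -- Transports the adjoints of `F` to adjoints of `Q` across the equivalence `G₀`.
  let e : S.Q ≅ F.functor ⋙ G₀.inv :=
    (Functor.rightUnitor _).symm ≪≫ Functor.isoWhiskerLeft S.Q G₀.asEquivalence.unitIso ≪≫
      (Functor.associator _ _ _).symm ≪≫ Functor.isoWhiskerRight (eqToIso hG₀) _
  let adjL' : G₀ ⋙ L ⊣ S.Q :=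
    (G₀.asEquivalence.toAdjunction.comp adjL).ofNatIsoRight e.symm
  let adjR' : S.Q ⊣ G₀ ⋙ R :=
    (adjR.comp G₀.asEquivalence.symm.toAdjunction).ofNatIsoLeft e.symm
  have hsat : ∀ {A B : C} (f : A ⟶ B), IsIso (S.Q.map f) → S f := by
    intro A B f hf
    rw [hS]
    change IsIso (F.functor.map f)
    rw [← hG₀]
    exact inferInstanceAs (IsIso (G₀.map (S.Q.map f)))
  -- Replaces `F` by the composite of `(Q, μ)` with `G`, so that `hF` becomes the exactness
  -- hypothesis on the composite in the earlier lemmas.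
  obtain ⟨G, hG, rfl⟩ := ExtData.exists_extFunctor adjL' adjR' G₀ F hG₀
  have := hequiv G.functor rfl
  refine ⟨ExtData.isGivenByFractions adjL' adjR' hsat,
    ExtData.isWeaklyExtriangulated_localization hX.toIsWeaklyExtriangulated hY hF adjL' adjR' hsat,
    ExtData.isExact_locQ hX.toIsWeaklyExtriangulated hY hF adjL' adjR' hsat,
    ⟨G, ⟨ExtData.isExact_of_comp hY hF, rfl⟩,
      fun G' hG' ↦ ExtData.extFunctor_ext adjL' adjR' G' G hG'.2⟩,
    fun G' _ hG' ↦ hequiv G'.functor (congrArg ExtFunctor.functor hG')⟩
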